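/- Let $X$ be a countable set, let $m:X\to(0,\infty)$, and let $\mu:X\times X\to[0,\infty)$, $(x,y)\mapsto\mu_{xy}$, be symmetric with $\mu_{xx}=0$ and $\sum_{y\in X}\mu_{xy}<\infty$ for all $x\in X$. Assume that the weighted graph $(X,\mu,m)$ is connected, i.e. any two vertices $x,y$ are joined by a finite path $x=x_0,x_1,\dots,x_n=y$ with $\mu_{x_{i-1}x_i}>0$ for $1\le i\le n$. A function $f:X\to\mathbb R$ is called harmonic if $\sum_{y}\mu_{xy}|f(y)|<\infty$ and $\Delta f(x)=\frac1{m(x)}\sum_{y}\mu_{xy}(f(x)-f(y))=0$ for all $x\in X$. A Hadamard space is a complete geodesic metric space $(Y,d)$ that is globally $\mathrm{CAT}(0)$: for every geodesic triangle, the distance between any two points of its sides is at most the distance between the corresponding points of a comparison triangle in the Euclidean plane. For $x\in X$ put $P_x(y)=\mu_{xy}/\sum_{z}\mu_{xz}$. A map $u:X\to Y$ into a Hadamard space is called harmonic if, for every $x\in X$, $\sum_y d(u(y),y_0)P_x(y)<\infty$ for all $y_0\in Y$, and $u(x)$ is the barycenter of the push-forward $u_*P_x$; here the barycenter of a probability measure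 $\nu$ on $Y$ with finite first moment is the unique minimizer of $z\mapsto\int_Y\bigl(d(z,y)^2-d(w,y)^2\bigr)\,\nu(dy)$, which does not depend on the choice of $w\in Y$. The energy of a map $u$ from $X$ into a metric space (in particular, of a function $X\to\mathbb R$) is $\frac12\sum_{x,y\in X}\mu_{xy}\,d(u(x),u(y))^2\in[0,\infty]$. **Theorem.** Assume that every harmonic function $f:X\to\mathbb R$ of finite energy is bounded. Then every harmonic map of finite energy from the graph into a Hadamard space is bounded, i.e. has bounded image. -/

import Mathlib

open MeasureTheory
open scoped ENNReal

noncomputable section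

/-- A weighted graph `(X, μ, m)` over a set `X`: a vertex measure `m : X → (0, ∞)` and a symmetric
edge weight `μ : X × X → [0, ∞)` with zero diagonal and `∑_y μ_{xy} < ∞` for every `x`.
The vertices `x`, `y` are joined by an edge iff `μ_{xy} > 0`. -/
structure WeightedGraph (X : Type*) where
  /-- the vertex measure -/
  m : X → ℝ
  /-- the edge weight -/
  μ : X → X → ℝ
  m_pos : ∀ x, 0 < m x
  μ_nonneg : ∀ x y, 0 ≤ μ x y
  μ_symm : ∀ x y, μ x y = μ y x
  μ_diag : ∀ x, μ x x = 0
  μ_summable : ∀ x, Summable (fun y => μ x y)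

namespace WeightedGraph

variable {X : Type*} (G : WeightedGraph X)

/-- `x ∼ y` -/
def Adj (x y : X) : Prop := 0 < G.μ x y

/-- Any two vertices are joined by a finite path `x = x₀ ∼ x₁ ∼ … ∼ xₙ = y`. -/
def Connected : Prop := ∀ x y, Relation.ReflTransGen G.Adj x y

/-- The formal domain `F(X)`. -/
def formalDomain : Set (X → ℝ) := {f | ∀ x, Summable (fun y => G.μ x y * |f y|)}

/-- The formal Laplacian `Δf(x) = m(x)⁻¹ ∑_y μ_{xy} (f(x) - f(y))`. -/
def laplacian (f : X → ℝ) (x : X) : ℝ := 1 / G.m x * ∑' y, G.μ x y * (f x - f y)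

/-- Harmonic functions. -/
def IsHarmonic (f : X → ℝ) : Prop := f ∈ G.formalDomain ∧ ∀ x, G.laplacian f x = 0

/-- The energy `½ ∑_{x,y} μ_{xy} d(u(x), u(y))² ∈ [0, ∞]` of a map into a metric space. For
`Y = ℝ`, where `d(a, b) = |a - b|`, this is the energy `E` of functions. -/
def energy {Y : Type*} [MetricSpace Y] (u : X → Y) : ℝ≥0∞ :=
  1 / 2 * ∑' x, ∑' y, ENNReal.ofReal (G.μ x y * dist (u x) (u y) ^ 2)

/-- The random walk transition probability `P_x(y) = μ_{xy} / ∑_z μ_{xz}`. -/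
def transProb (x y : X) : ℝ := G.μ x y / ∑' z, G.μ x z

/-- The random walk measure `P_x` on the discrete space `X`, that is, `∑_y P_x(y) δ_y`. -/
def walkMeasure [MeasurableSpace X] (x : X) : Measure X :=
  Measure.sum fun y => ENNReal.ofReal (G.transProb x y) • Measure.dirac y

end WeightedGraph

/-- `γ`, restricted to `[0, 1]`, is a (constant speed) minimal geodesic from `p` to `q`. -/
def IsGeodesic {Y : Type*} [MetricSpace Y] (γ : ℝ → Y) (p q : Y) : Prop :=
  γ 0 = p ∧ γ 1 = q ∧
    ∀ s ∈ Set.Icc (0 : ℝ) 1, ∀ t ∈ Set.Icc (0 : ℝ) 1, dist (γ s) (γ t) = |s - t| * dist p q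

/-- A Hadamard space (complete `CAT(0)` space): a complete geodesic metric space all of whose
geodesic triangles are at least as thin as their comparison triangles in the Euclidean plane. As
any two sides of a triangle have a common vertex `p`, it is enough to compare points on the sides
`[p, q]` and `[p, r]` of an arbitrary triangle `p q r`. -/
structure IsHadamardSpace (Y : Type*) [MetricSpace Y] : Prop where
  complete : CompleteSpace Y
  geodesic : ∀ p q : Y, ∃ γ : ℝ → Y, IsGeodesic γ p q
  comparison : ∀ (p q r : Y) (α β : ℝ → Y), IsGeodesic α p q → IsGeodesic β p r →
    ∀ p' q' r' : EuclideanSpace ℝ (Fin 2),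
      dist p' q' = dist p q → dist p' r' = dist p r → dist q' r' = dist q r →
      ∀ s ∈ Set.Icc (0 : ℝ) 1, ∀ t ∈ Set.Icc (0 : ℝ) 1,
        dist (α s) (β t) ≤ dist (AffineMap.lineMap p' q' s) (AffineMap.lineMap p' r' t)

/-- `z` is the barycenter of `ν`, that is, the minimizer of
`z ↦ ∫ (d(z, y)² - d(w, y)²) ν(dy)`. The choice of the point `w` is irrelevant: for `ν` with finite
first moment the integrand is integrable and two such functionals differ by a constant. In a
Hadamard space, a probability measure with finite first moment has exactly one minimizer. -/
def IsBarycenter {Y : Type*} [MetricSpace Y] [MeasurableSpace Y] (ν : Measure Y) (z : Y) : Prop :=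
  ∀ w, ∫ y, (dist z y ^ 2 - dist w y ^ 2) ∂ν ≤ 0

namespace WeightedGraph

variable {X : Type*} (G : WeightedGraph X)

/-- The class `F(X, Y)` of maps for which all `u_* P_x` have finite first moment. -/
def mapDomain (Y : Type*) [MetricSpace Y] : Set (X → Y) :=
  {u | ∀ (x : X) (y₀ : Y), Summable (fun y => dist (u y) y₀ * G.transProb x y)}

/-- Harmonic maps: `u ∈ F(X, Y)` and `u(x)` is the barycenter of `u_* P_x` for every `x`. -/
def IsHarmonicMap [MeasurableSpace X] {Y : Type*} [MetricSpace Y] [MeasurableSpace Y]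
    (u : X → Y) : Prop :=
  u ∈ G.mapDomain Y ∧ ∀ x, IsBarycenter ((G.walkMeasure x).map u) (u x)

end WeightedGraph

end

/-! Write `P` for the random walk average and `D` for the Dirichlet sum. In a Hadamard space the
variance inequality for barycenters makes `f = d(u(·), u(o))` subharmonic, and the triangle
inequality gives it finite energy. It then suffices to dominate `f` by a harmonic function of finite
energy, which is bounded by hypothesis (`FiniteEnergy.exists_harmonic_majorant`).

The iterates `P^k f` increase, and their energies do not, because `P` contracts `D`
(`FiniteEnergy.dirichlet_average_le`). The energy bound controls differences along edges, so by
connectedness the iterates are bounded at every vertex or at none. If bounded, they converge to a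
harmonic majorant, of finite energy by Fatou. If unbounded, Green's formula for `f` against `P^k f -
f` bounds `∑ deg (Pf - f)(P^k f - f)` uniformly in `k`; a vertex with `Pf > f` would then keep the
iterates bounded there. Hence `Pf = f`, and `f` is its own majorant. -/

noncomputable section

namespace WeightedGraph

variable {X : Type*} (G : WeightedGraph X)

/-- The total weight `∑_y μ_{xy}` of the edges at `x`. -/
def degree (x : X) : ℝ := ∑' y, G.μ x y

/-- The random walk average `∑_y P_x(y) f(y)`. -/
def average (f : X → ℝ) (x : X) : ℝ := (∑' y, G.μ x y * f y) / G.degree x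

/-- Finiteness of the Dirichlet sum of a function. -/
def FiniteEnergy (f : X → ℝ) : Prop :=
  Summable fun p : X × X => G.μ p.1 p.2 * (f p.1 - f p.2) ^ 2

/-- The Dirichlet sum `∑_{x,y} μ_{xy} (f(x) - f(y))²`, twice the energy. -/
def dirichlet (f : X → ℝ) : ℝ := ∑' p : X × X, G.μ p.1 p.2 * (f p.1 - f p.2) ^ 2

/-- Square summability with respect to the degree. -/
def SqSummable (g : X → ℝ) : Prop := Summable fun x => G.degree x * g x ^ 2

/-! ### Functions of finite energy -/

variable {G} {f g : X → ℝ}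

lemma FiniteEnergy.summable_row (hf : G.FiniteEnergy f) (x : X) :
    Summable fun y => G.μ x y * (f x - f y) ^ 2 :=
  hf.comp_injective (i := fun y => (x, y)) fun _ _ h => (Prod.ext_iff.1 h).2

lemma FiniteEnergy.summable_sub (hf : G.FiniteEnergy f) (x : X) :
    Summable fun y => G.μ x y * (f x - f y) := by
  refine Summable.of_norm_bounded ((G.μ_summable x).add (hf.summable_row x)) fun y => ?_
  have h := G.μ_nonneg x y
  rw [Real.norm_eq_abs, abs_le]
  constructor <;> nlinarith [mul_nonneg h (sq_nonneg (f x - f y + 1 / 2)),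
    mul_nonneg h (sq_nonneg (f x - f y - 1 / 2))]

lemma FiniteEnergy.summable_mul (hf : G.FiniteEnergy f) (x : X) :
    Summable fun y => G.μ x y * f y := by
  refine (((G.μ_summable x).mul_right (f x)).sub (hf.summable_sub x)).congr fun y => ?_
  ring

lemma FiniteEnergy.tsum_sub (hf : G.FiniteEnergy f) {x : X} (hx : 0 < G.degree x) :
    ∑' y, G.μ x y * (f x - f y) = G.degree x * (f x - G.average f x) := by
  have h : ∑' y, G.μ x y * (f x - f y) = ∑' y, (G.μ x y * f x - G.μ x y * f y) :=
    tsum_congr fun y => by ring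
  rw [h, ((G.μ_summable x).mul_right _).tsum_sub (hf.summable_mul x), tsum_mul_right, average,
    mul_sub, mul_div_cancel₀ _ hx.ne']
  rfl

lemma FiniteEnergy.add (hf : G.FiniteEnergy f) (hg : G.FiniteEnergy g) :
    G.FiniteEnergy fun x => f x + g x := by
  refine Summable.of_nonneg_of_le (fun p => mul_nonneg (G.μ_nonneg _ _) (sq_nonneg _)) (fun p => ?_)
    ((hf.mul_left 2).add (hg.mul_left 2))
  nlinarith [mul_nonneg (G.μ_nonneg p.1 p.2) (sq_nonneg ((f p.1 - f p.2) - (g p.1 - g p.2)))]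

lemma FiniteEnergy.neg (hf : G.FiniteEnergy f) : G.FiniteEnergy fun x => - f x :=
  hf.congr fun p => by ring

lemma FiniteEnergy.sub (hf : G.FiniteEnergy f) (hg : G.FiniteEnergy g) :
    G.FiniteEnergy fun x => f x - g x := by
  simpa only [sub_eq_add_neg] using hf.add hg.neg

lemma FiniteEnergy.summable_mul_mul (hf : G.FiniteEnergy f) (hg : G.FiniteEnergy g) :
    Summable fun p : X × X => G.μ p.1 p.2 * ((f p.1 - f p.2) * (g p.1 - g p.2)) := by
  refine Summable.of_norm_bounded (Summable.add hf hg) fun p => ?_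
  have h := G.μ_nonneg p.1 p.2
  rw [Real.norm_eq_abs, abs_le]
  constructor <;> nlinarith [mul_nonneg h (sq_nonneg ((f p.1 - f p.2) - (g p.1 - g p.2))),
    mul_nonneg h (sq_nonneg ((f p.1 - f p.2) + (g p.1 - g p.2))),
    mul_nonneg h (sq_nonneg (f p.1 - f p.2)), mul_nonneg h (sq_nonneg (g p.1 - g p.2))]

lemma FiniteEnergy.neg_tsum_mul_mul_le (hf : G.FiniteEnergy f) (hg : G.FiniteEnergy g) :
    -∑' p : X × X, G.μ p.1 p.2 * ((f p.1 - f p.2) * (g p.1 - g p.2)) ≤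
      G.dirichlet f + G.dirichlet g := by
  rw [← tsum_neg, dirichlet, dirichlet, ← Summable.tsum_add hf hg]
  refine (hf.summable_mul_mul hg).neg.tsum_le_tsum (fun p => ?_) (Summable.add hf hg)
  nlinarith [mul_nonneg (G.μ_nonneg p.1 p.2) (sq_nonneg ((f p.1 - f p.2) + (g p.1 - g p.2))),
    mul_nonneg (G.μ_nonneg p.1 p.2) (sq_nonneg (f p.1 - f p.2)),
    mul_nonneg (G.μ_nonneg p.1 p.2) (sq_nonneg (g p.1 - g p.2))]

lemma FiniteEnergy.dirichlet_sub (hf : G.FiniteEnergy f) (hg : G.FiniteEnergy g) :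
    G.dirichlet (fun x => f x - g x) = G.dirichlet f -
      2 * ∑' p : X × X, G.μ p.1 p.2 * ((f p.1 - f p.2) * (g p.1 - g p.2)) + G.dirichlet g := by
  have h := hf.summable_mul_mul hg
  rw [dirichlet, dirichlet, dirichlet, ← tsum_mul_left,
    ← Summable.tsum_sub hf (h.mul_left 2), ← (Summable.sub hf (h.mul_left 2)).tsum_add hg]
  exact tsum_congr fun p => by ring

lemma FiniteEnergy.dirichlet_sub_le (hf : G.FiniteEnergy f) (hg : G.FiniteEnergy g) :
    G.dirichlet (fun x => f x - g x) ≤ 2 * G.dirichlet f + 2 * G.dirichlet g := by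
  rw [dirichlet, dirichlet, dirichlet, ← tsum_mul_left, ← tsum_mul_left,
    ← (hf.mul_left 2).tsum_add (hg.mul_left 2)]
  refine Summable.tsum_le_tsum (fun p => ?_) (hf.sub hg) ((hf.mul_left 2).add (hg.mul_left 2))
  nlinarith [mul_nonneg (G.μ_nonneg p.1 p.2) (sq_nonneg ((f p.1 - f p.2) + (g p.1 - g p.2)))]

lemma FiniteEnergy.mul_sq_sub_le (hf : G.FiniteEnergy f) (x y : X) :
    G.μ x y * (f x - f y) ^ 2 ≤ G.dirichlet f :=
  hf.le_tsum (x, y) fun _ _ => mul_nonneg (G.μ_nonneg _ _) (sq_nonneg _)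

/-- The variance of `f` under one step from `x` is nonnegative; expanding it around the mean gives
the bound. -/
lemma FiniteEnergy.degree_mul_sq_le (hf : G.FiniteEnergy f) {x : X} (hx : 0 < G.degree x) :
    G.degree x * (f x - G.average f x) ^ 2 ≤ ∑' y, G.μ x y * (f x - f y) ^ 2 := by
  set a := f x - G.average f x with ha
  have h1 := hf.summable_row x
  have h2 := (hf.summable_sub x).mul_left (2 * a)
  have h3 := (G.μ_summable x).mul_right (a ^ 2)
  have h : 0 ≤ ∑' y, G.μ x y * (f x - f y - a) ^ 2 :=
    tsum_nonneg fun y => mul_nonneg (G.μ_nonneg _ _) (sq_nonneg _)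
  have e : ∑' y, G.μ x y * (f x - f y - a) ^ 2 = ∑' y, (G.μ x y * (f x - f y) ^ 2
      - 2 * a * (G.μ x y * (f x - f y)) + G.μ x y * a ^ 2) := tsum_congr fun y => by ring
  rw [e, (h1.sub h2).tsum_add h3, h1.tsum_sub h2, tsum_mul_left, tsum_mul_right,
    hf.tsum_sub hx, ← ha] at h
  change 0 ≤ _ - _ + G.degree x * a ^ 2 at h
  linarith

lemma FiniteEnergy.sqSummable_sub_average (hf : G.FiniteEnergy f) (hd : ∀ x, 0 < G.degree x) :
    G.SqSummable fun x => f x - G.average f x :=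
  Summable.of_nonneg_of_le (fun x => mul_nonneg (hd x).le (sq_nonneg _))
    (fun x => hf.degree_mul_sq_le (hd x)) hf.prod

/-! ### Degree-square-summable functions and Green's formula -/

lemma tsum_mul_const_row (x : X) (c : ℝ) : ∑' y, G.μ x y * c = G.degree x * c :=
  tsum_mul_right

lemma SqSummable.summable_fst (hg : G.SqSummable g) :
    Summable fun p : X × X => G.μ p.1 p.2 * g p.1 ^ 2 := by
  rw [summable_prod_of_nonneg fun _ => mul_nonneg (G.μ_nonneg _ _) (sq_nonneg _)]
  refine ⟨fun x => (G.μ_summable x).mul_right (g x ^ 2), ?_⟩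
  simp only [tsum_mul_const_row]
  exact hg

lemma SqSummable.tsum_fst (hg : G.SqSummable g) :
    ∑' p : X × X, G.μ p.1 p.2 * g p.1 ^ 2 = ∑' x, G.degree x * g x ^ 2 := by
  rw [hg.summable_fst.tsum_prod]
  exact tsum_congr fun x => tsum_mul_const_row x (g x ^ 2)

lemma SqSummable.summable_snd (hg : G.SqSummable g) :
    Summable fun p : X × X => G.μ p.1 p.2 * g p.2 ^ 2 := by
  refine (hg.summable_fst.prod_symm).congr fun p => ?_
  simp [G.μ_symm p.1 p.2]

lemma SqSummable.tsum_snd (hg : G.SqSummable g) :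
    ∑' p : X × X, G.μ p.1 p.2 * g p.2 ^ 2 = ∑' x, G.degree x * g x ^ 2 := by
  rw [← hg.tsum_fst, ← (Equiv.prodComm X X).tsum_eq]
  exact tsum_congr fun p => by simp [G.μ_symm p.1 p.2]

lemma SqSummable.finiteEnergy (hg : G.SqSummable g) : G.FiniteEnergy g := by
  refine Summable.of_nonneg_of_le (fun p => mul_nonneg (G.μ_nonneg _ _) (sq_nonneg _)) (fun p => ?_)
    ((hg.summable_fst.mul_left 2).add (hg.summable_snd.mul_left 2))
  nlinarith [mul_nonneg (G.μ_nonneg p.1 p.2) (sq_nonneg (g p.1 + g p.2))]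

lemma SqSummable.dirichlet_le (hg : G.SqSummable g) :
    G.dirichlet g ≤ 4 * ∑' x, G.degree x * g x ^ 2 := by
  have h1 := hg.summable_fst.mul_left 2
  have h2 := hg.summable_snd.mul_left 2
  have h : G.dirichlet g ≤ ∑' p : X × X,
      (2 * (G.μ p.1 p.2 * g p.1 ^ 2) + 2 * (G.μ p.1 p.2 * g p.2 ^ 2)) := by
    refine hg.finiteEnergy.tsum_le_tsum (fun p => ?_) (h1.add h2)
    nlinarith [mul_nonneg (G.μ_nonneg p.1 p.2) (sq_nonneg (g p.1 + g p.2))]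
  rw [h1.tsum_add h2, tsum_mul_left, tsum_mul_left, hg.tsum_fst, hg.tsum_snd] at h
  linarith

lemma SqSummable.sub (hd : ∀ x, 0 < G.degree x) (hf : G.SqSummable f) (hg : G.SqSummable g) :
    G.SqSummable fun x => f x - g x := by
  refine Summable.of_nonneg_of_le (fun x => mul_nonneg (hd x).le (sq_nonneg _)) (fun x => ?_)
    ((hf.mul_left 2).add (hg.mul_left 2))
  nlinarith [mul_nonneg (hd x).le (sq_nonneg (f x + g x))]

/-- Green's formula: absolute convergence and value of `∑_x deg(x) (f - Pf)(x) g(x)`. -/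
lemma FiniteEnergy.hasSum_green (hd : ∀ x, 0 < G.degree x) (hf : G.FiniteEnergy f)
    (hg : G.SqSummable g) :
    HasSum (fun x => G.degree x * (f x - G.average f x) * g x)
      (1 / 2 * ∑' p : X × X, G.μ p.1 p.2 * ((f p.1 - f p.2) * (g p.1 - g p.2))) := by
  have hs : Summable fun p : X × X => G.μ p.1 p.2 * (f p.1 - f p.2) * g p.1 := by
    refine Summable.of_norm_bounded (Summable.add hf hg.summable_fst) fun p => ?_
    have h := G.μ_nonneg p.1 p.2
    rw [Real.norm_eq_abs, abs_le]
    constructor <;> nlinarith [mul_nonneg h (sq_nonneg ((f p.1 - f p.2) - g p.1)),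
      mul_nonneg h (sq_nonneg ((f p.1 - f p.2) + g p.1)),
      mul_nonneg h (sq_nonneg (f p.1 - f p.2)), mul_nonneg h (sq_nonneg (g p.1))]
  have hrow : ∀ x, ∑' y, G.μ x y * (f x - f y) * g x =
      G.degree x * (f x - G.average f x) * g x := fun x => by
    rw [tsum_mul_right, hf.tsum_sub (hd x)]
  have hval : ∑' x, G.degree x * (f x - G.average f x) * g x =
      ∑' p : X × X, G.μ p.1 p.2 * (f p.1 - f p.2) * g p.1 := by
    rw [hs.tsum_prod]
    exact tsum_congr fun x => (hrow x).symm
  -- Exchanging `x` and `y` flips the sign of the difference; averaging both forms produces the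
  -- factor `1/2`.
  have hswap : ∑' p : X × X, G.μ p.1 p.2 * (f p.1 - f p.2) * g p.1 =
      ∑' p : X × X, -(G.μ p.1 p.2 * (f p.1 - f p.2) * g p.2) := by
    rw [← (Equiv.prodComm X X).tsum_eq]
    refine tsum_congr fun p => ?_
    simp only [Equiv.prodComm_apply, Prod.fst_swap, Prod.snd_swap, G.μ_symm p.2 p.1]
    ring
  have hs' : Summable fun p : X × X => -(G.μ p.1 p.2 * (f p.1 - f p.2) * g p.2) := by
    refine hs.prod_symm.congr fun p => ?_
    simp only [Prod.fst_swap, Prod.snd_swap, G.μ_symm p.2 p.1]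
    ring
  have hsum : ∑' p : X × X, G.μ p.1 p.2 * ((f p.1 - f p.2) * (g p.1 - g p.2)) =
      ∑' p : X × X, G.μ p.1 p.2 * (f p.1 - f p.2) * g p.1 +
      ∑' p : X × X, -(G.μ p.1 p.2 * (f p.1 - f p.2) * g p.2) := by
    rw [← hs.tsum_add hs']
    exact tsum_congr fun p => by ring
  have hfin : 1 / 2 * ∑' p : X × X, G.μ p.1 p.2 * ((f p.1 - f p.2) * (g p.1 - g p.2)) =
      ∑' x, G.degree x * (f x - G.average f x) * g x := by
    rw [hsum, ← hswap, hval]; ring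
  rw [hfin]
  exact (hs.prod.congr fun x => hrow x).hasSum

/-! ### Iterated averages and harmonic majorants -/

lemma average_eq_sub : G.average f = fun x => f x - (f x - G.average f x) := by
  funext x; ring

lemma FiniteEnergy.average (hd : ∀ x, 0 < G.degree x) (hf : G.FiniteEnergy f) :
    G.FiniteEnergy (G.average f) := by
  rw [average_eq_sub]
  exact hf.sub (hf.sqSummable_sub_average hd).finiteEnergy

/-- The random walk average does not increase the energy. -/
lemma FiniteEnergy.dirichlet_average_le (hd : ∀ x, 0 < G.degree x) (hf : G.FiniteEnergy f) :
    G.dirichlet (G.average f) ≤ G.dirichlet f := by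
  -- With `g = f - Pf` and `N = ∑ deg g²`, Green's formula makes the cross term in `D(f - g)` equal
  -- to `-4N`, which absorbs `D(g) ≤ 4N`.
  have hg := hf.sqSummable_sub_average hd
  have h1 := (hf.hasSum_green hd hg).tsum_eq
  have h2 := hg.dirichlet_le
  have h3 : ∑' x, G.degree x * (f x - G.average f x) * (f x - G.average f x) =
      ∑' x, G.degree x * (f x - G.average f x) ^ 2 := tsum_congr fun x => by ring
  rw [average_eq_sub, hf.dirichlet_sub hg.finiteEnergy]
  linarith

lemma FiniteEnergy.average_mono (hd : ∀ x, 0 < G.degree x) (hf : G.FiniteEnergy f)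
    (hg : G.FiniteEnergy g) (hfg : f ≤ g) : G.average f ≤ G.average g := fun x => by
  refine div_le_div_of_nonneg_right ?_ (hd x).le
  exact (hf.summable_mul x).tsum_le_tsum
    (fun y => mul_le_mul_of_nonneg_left (hfg y) (G.μ_nonneg x y)) (hg.summable_mul x)

lemma FiniteEnergy.iterate_average (hd : ∀ x, 0 < G.degree x) (hf : G.FiniteEnergy f) (k : ℕ) :
    G.FiniteEnergy (G.average^[k] f) := by
  induction k with
  | zero => exact hf
  | succ k ih => rw [Function.iterate_succ_apply']; exact ih.average hd

lemma FiniteEnergy.dirichlet_iterate_average_le (hd : ∀ x, 0 < G.degree x)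
    (hf : G.FiniteEnergy f) (k : ℕ) : G.dirichlet (G.average^[k] f) ≤ G.dirichlet f := by
  induction k with
  | zero => exact le_rfl
  | succ k ih =>
    rw [Function.iterate_succ_apply']
    exact ((hf.iterate_average hd k).dirichlet_average_le hd).trans ih

lemma FiniteEnergy.monotone_iterate_average (hd : ∀ x, 0 < G.degree x)
    (hf : G.FiniteEnergy f) (hsub : f ≤ G.average f) : Monotone fun k => G.average^[k] f := by
  have h : ∀ k, G.average^[k] f ≤ G.average (G.average^[k] f) := fun k => by
    induction k with
    | zero => exact hsub
    | succ k ih =>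
      have hk := hf.iterate_average hd k
      simp only [Function.iterate_succ_apply']
      exact hk.average_mono hd (hk.average hd) ih
  refine monotone_nat_of_le_succ fun k => ?_
  rw [Function.iterate_succ_apply']
  exact h k

/-- Telescoping into one-step differences makes `P^k f - f` an admissible test function in Green's
formula, although `f` itself need not be square summable. -/
lemma FiniteEnergy.sqSummable_iterate_average_sub (hd : ∀ x, 0 < G.degree x)
    (hf : G.FiniteEnergy f) (k : ℕ) : G.SqSummable fun x => G.average^[k] f x - f x := by
  induction k with
  | zero => simp [SqSummable, summable_zero]
  | succ k ih =>
    have h : (fun x => G.average^[k + 1] f x - f x) = fun x => (G.average^[k] f x - f x) -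
        (G.average^[k] f x - G.average (G.average^[k] f) x) := by
      funext x
      rw [Function.iterate_succ_apply']
      ring
    rw [h]
    exact ih.sub hd ((hf.iterate_average hd k).sqSummable_sub_average hd)

/-- If the iterated averages of a subharmonic function of finite energy are unbounded at every
vertex, then the function is harmonic. -/
lemma FiniteEnergy.average_eq_of_unbounded (hd : ∀ x, 0 < G.degree x) (hf : G.FiniteEnergy f)
    (hsub : f ≤ G.average f) (hunb : ∀ x, ¬ BddAbove (Set.range fun k => G.average^[k] f x)) :
    G.average f = f := by
  funext x
  by_contra hne
  have hlt : 0 < G.degree x * (G.average f x - f x) :=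
    mul_pos (hd x) (sub_pos.2 (lt_of_le_of_ne (hsub x) (Ne.symm hne)))
  -- For `φ = P^k f - f`, one nonnegative term of Green's sum is at most `(D(f) + D(φ))/2`, and
  -- `D(φ) ≤ 2 D(P^k f) + 2 D(f) ≤ 4 D(f)`; hence `5/2`.
  refine hunb x ⟨f x + 5 / 2 * G.dirichlet f / (G.degree x * (G.average f x - f x)), ?_⟩
  rintro _ ⟨k, rfl⟩
  have hφ := hf.sqSummable_iterate_average_sub hd k
  have hk := hf.iterate_average hd k
  have hsum := (hf.hasSum_green hd hφ).neg
  have h1 := le_hasSum hsum x fun y _ => by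
    have h0 : f y ≤ G.average^[k] f y := hf.monotone_iterate_average hd hsub (Nat.zero_le k) y
    have := mul_nonneg (mul_nonneg (hd y).le (sub_nonneg.2 (hsub y))) (sub_nonneg.2 h0)
    linarith
  have h2 := hf.neg_tsum_mul_mul_le hφ.finiteEnergy
  have h3 := hk.dirichlet_sub_le hf
  have h4 := hf.dirichlet_iterate_average_le hd k
  have h5 : (G.average^[k] f x - f x) * (G.degree x * (G.average f x - f x)) ≤
      5 / 2 * G.dirichlet f := by linarith
  have h6 := (le_div_iff₀ hlt).2 h5
  change G.average^[k] f x ≤ _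
  linarith

/-- If the iterated averages of a subharmonic function of finite energy are bounded at every
vertex, then it has a harmonic majorant of finite energy. -/
lemma FiniteEnergy.exists_majorant_of_bounded (hd : ∀ x, 0 < G.degree x) (hf : G.FiniteEnergy f)
    (hsub : f ≤ G.average f) (hbd : ∀ x, BddAbove (Set.range fun k => G.average^[k] f x)) :
    ∃ h, G.FiniteEnergy h ∧ G.average h = h ∧ f ≤ h := by
  have hmono := hf.monotone_iterate_average hd hsub
  have hlim : ∀ x, Filter.Tendsto (fun k => G.average^[k] f x) Filter.atTop
      (nhds (⨆ k, G.average^[k] f x)) := fun x =>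
    tendsto_atTop_ciSup (fun _ _ hij => hmono hij x) (hbd x)
  set h : X → ℝ := fun x => ⨆ k, G.average^[k] f x with hh
  have hle : ∀ k x, G.average^[k] f x ≤ h x := fun k x => le_ciSup (hbd x) k
  have hge : ∀ k x, f x ≤ G.average^[k] f x := fun k x => hmono (Nat.zero_le k) x
  have hE : G.FiniteEnergy h := by
    -- Fatou's argument: finite partial sums pass to the limit under the uniform energy bound.
    refine summable_of_sum_le (c := G.dirichlet f)
      (fun p => mul_nonneg (G.μ_nonneg _ _) (sq_nonneg _)) fun s => ?_
    refine le_of_tendsto (tendsto_finsetSum s fun p _ =>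
      (((hlim p.1).sub (hlim p.2)).pow 2).const_mul (G.μ p.1 p.2)) (Filter.Eventually.of_forall ?_)
    intro k
    exact ((hf.iterate_average hd k).sum_le_tsum s
      fun p _ => mul_nonneg (G.μ_nonneg _ _) (sq_nonneg _)).trans
      (hf.dirichlet_iterate_average_le hd k)
  refine ⟨h, hE, ?_, fun x => hle 0 x⟩
  funext x
  refine tendsto_nhds_unique (f := fun k => G.average^[k + 1] f x) (l := Filter.atTop) ?_
    ((hlim x).comp (Filter.tendsto_add_atTop_nat 1))
  simp only [Function.iterate_succ_apply']
  refine Filter.Tendsto.div_const ?_ _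
  -- Since `f ≤ P^k f ≤ h`, both ends being summable against `μ x ·`, the limit may be taken inside
  -- `P`.
  refine tendsto_tsum_of_dominated_convergence
    (bound := fun y => |G.μ x y * f y| + |G.μ x y * h y|)
    ((hf.summable_mul x).abs.add (hE.summable_mul x).abs) (fun y => (hlim y).const_mul _)
    (Filter.Eventually.of_forall fun k y => ?_)
  have hμ := G.μ_nonneg x y
  have h1 := mul_le_mul_of_nonneg_left (hle k y) hμ
  have h2 := mul_le_mul_of_nonneg_left (hge k y) hμ
  rw [Real.norm_eq_abs, abs_le]
  constructor
  · linarith [neg_abs_le (G.μ x y * f y), abs_nonneg (G.μ x y * h y)]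
  · linarith [le_abs_self (G.μ x y * h y), abs_nonneg (G.μ x y * f y)]

/-- A single edge already carries at most `D(f)`, uniformly in `k`, so the iterates at its ends stay
a bounded distance apart; `t ≤ t² + 1` avoids a square root. -/
lemma FiniteEnergy.bddAbove_iterate_of_adj (hd : ∀ x, 0 < G.degree x) (hf : G.FiniteEnergy f)
    {x y : X} (hxy : G.Adj x y) (hx : BddAbove (Set.range fun k => G.average^[k] f x)) :
    BddAbove (Set.range fun k => G.average^[k] f y) := by
  obtain ⟨C, hC⟩ := hx
  refine ⟨C + (G.dirichlet f / G.μ x y + 1), ?_⟩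
  rintro _ ⟨k, rfl⟩
  have h1 : G.average^[k] f x ≤ C := hC ⟨k, rfl⟩
  have h2 := ((hf.iterate_average hd k).mul_sq_sub_le x y).trans
    (hf.dirichlet_iterate_average_le hd k)
  rw [mul_comm] at h2
  have h3 := (le_div_iff₀ hxy).2 h2
  change G.average^[k] f y ≤ _
  nlinarith [sq_nonneg (G.average^[k] f x - G.average^[k] f y + 1)]

/-- On a connected graph, every subharmonic function of finite energy has a harmonic majorant of
finite energy. -/
theorem FiniteEnergy.exists_harmonic_majorant (hG : G.Connected) (hd : ∀ x, 0 < G.degree x)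
    (hf : G.FiniteEnergy f) (hsub : f ≤ G.average f) :
    ∃ h, G.FiniteEnergy h ∧ G.average h = h ∧ f ≤ h := by
  by_cases hb : ∃ x, BddAbove (Set.range fun k => G.average^[k] f x)
  · obtain ⟨x, hx⟩ := hb
    refine hf.exists_majorant_of_bounded hd hsub fun y => ?_
    induction hG x y with
    | refl => exact hx
    | tail _ h ih => exact hf.bddAbove_iterate_of_adj hd h ih
  · push Not at hb
    exact ⟨f, hf, hf.average_eq_of_unbounded hd hsub hb, le_rfl⟩

/-! ### Harmonicity, energy of maps and positivity of degrees -/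

lemma FiniteEnergy.isHarmonic (hd : ∀ x, 0 < G.degree x) (hf : G.FiniteEnergy f)
    (h : G.average f = f) : G.IsHarmonic f := by
  refine ⟨fun x => ?_, fun x => ?_⟩
  · refine (hf.summable_mul x).abs.congr fun y => ?_
    rw [abs_mul, abs_of_nonneg (G.μ_nonneg x y)]
  · rw [laplacian, hf.tsum_sub (hd x), h]
    simp

lemma energy_eq_tsum_prod {Y : Type*} [MetricSpace Y] (u : X → Y) :
    G.energy u = 1 / 2 *
      ∑' p : X × X, ENNReal.ofReal (G.μ p.1 p.2 * dist (u p.1) (u p.2) ^ 2) := by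
  rw [energy, ENNReal.tsum_prod']

lemma FiniteEnergy.energy_lt_top (hf : G.FiniteEnergy f) : G.energy f < ∞ := by
  rw [energy_eq_tsum_prod]
  refine ENNReal.mul_lt_top (by simp) ?_
  simp only [Real.dist_eq, sq_abs]
  exact hf.tsum_ofReal_lt_top

lemma summable_of_energy_lt_top {Y : Type*} [MetricSpace Y] {u : X → Y} (hu : G.energy u < ∞) :
    Summable fun p : X × X => G.μ p.1 p.2 * dist (u p.1) (u p.2) ^ 2 := by
  rw [energy_eq_tsum_prod] at hu
  have h : ∑' p : X × X, ENNReal.ofReal (G.μ p.1 p.2 * dist (u p.1) (u p.2) ^ 2) ≠ ∞ := by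
    intro h
    simp [h] at hu
  refine (ENNReal.summable_toReal h).congr fun p => ?_
  exact ENNReal.toReal_ofReal (mul_nonneg (G.μ_nonneg _ _) (sq_nonneg _))

lemma finiteEnergy_dist {Y : Type*} [MetricSpace Y] {u : X → Y} (hu : G.energy u < ∞) (y₀ : Y) :
    G.FiniteEnergy fun x => dist (u x) y₀ := by
  refine Summable.of_nonneg_of_le (fun p => mul_nonneg (G.μ_nonneg _ _) (sq_nonneg _)) (fun p => ?_)
    (summable_of_energy_lt_top hu)
  refine mul_le_mul_of_nonneg_left ?_ (G.μ_nonneg _ _)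
  rw [← sq_abs]
  exact pow_le_pow_left₀ (abs_nonneg _) (abs_dist_sub_le _ _ _) 2

lemma degree_pos [Nontrivial X] (hG : G.Connected) (x : X) : 0 < G.degree x := by
  obtain ⟨y, hy⟩ := exists_ne x
  obtain h | ⟨z, hz, -⟩ := (hG x y).cases_head
  · exact absurd h.symm hy
  · exact lt_of_lt_of_le hz ((G.μ_summable x).le_tsum z fun y _ => G.μ_nonneg x y)

end WeightedGraph

end

noncomputable section

/-! ### Comparison triangles and the `CAT(0)` inequality -/

lemma exists_euclidean_triangle {a b c : ℝ} (ha : 0 ≤ a) (hb : 0 ≤ b) (hc : 0 ≤ c)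
    (hab : c ≤ a + b) (hac : b ≤ a + c) (hbc : a ≤ b + c) :
    ∃ p q r : EuclideanSpace ℝ (Fin 2), dist p q = a ∧ dist p r = b ∧ dist q r = c := by
  rcases ha.eq_or_lt with rfl | ha'
  · obtain rfl : b = c := by linarith
    refine ⟨!₂[0, 0], !₂[0, 0], !₂[b, 0], ?_, ?_, ?_⟩ <;>
      simp [EuclideanSpace.dist_eq, Real.sqrt_sq, hb]
  -- The law of cosines gives the first coordinate of the third vertex.
  · set s := (a ^ 2 + b ^ 2 - c ^ 2) / (2 * a) with hs
    have hs' : 2 * a * s = a ^ 2 + b ^ 2 - c ^ 2 := by rw [hs]; field_simp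
    have h1 : s ≤ b := by
      have : a ^ 2 + b ^ 2 - c ^ 2 ≤ 2 * a * b := by
        nlinarith [mul_nonneg (sub_nonneg.2 hac) (sub_nonneg.2 hbc)]
      nlinarith
    have h2 : -b ≤ s := by
      have : -(2 * a * b) ≤ a ^ 2 + b ^ 2 - c ^ 2 := by nlinarith
      nlinarith
    have h3 : 0 ≤ b ^ 2 - s ^ 2 := by nlinarith
    refine ⟨!₂[0, 0], !₂[a, 0], !₂[s, Real.sqrt (b ^ 2 - s ^ 2)], ?_, ?_, ?_⟩
    · simp [EuclideanSpace.dist_eq, Real.sqrt_sq, ha]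
    · simp [EuclideanSpace.dist_eq, Real.sq_sqrt h3, Real.sqrt_sq hb]
    · have : (a - s) ^ 2 + (b ^ 2 - s ^ 2) = c ^ 2 := by linarith
      simp [EuclideanSpace.dist_eq, Real.dist_eq, Real.sq_sqrt h3, this, Real.sqrt_sq hc]

/-- Stewart's theorem, the Euclidean equality case of the `CAT(0)` inequality. -/
lemma euclidean_dist_lineMap_sq (p q r : EuclideanSpace ℝ (Fin 2)) (t : ℝ) :
    dist (AffineMap.lineMap p q t) r ^ 2 =
      (1 - t) * dist p r ^ 2 + t * dist q r ^ 2 - t * (1 - t) * dist p q ^ 2 := by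
  have h : ∀ v w : EuclideanSpace ℝ (Fin 2),
      dist v w ^ 2 = (v 0 - w 0) ^ 2 + (v 1 - w 1) ^ 2 := fun v w => by
    rw [EuclideanSpace.dist_eq, Real.sq_sqrt (Finset.sum_nonneg fun _ _ => sq_nonneg _)]
    simp [Real.dist_eq]
  rw [h, h, h, h]
  simp only [AffineMap.lineMap_apply, vsub_eq_sub, vadd_eq_add, PiLp.add_apply, PiLp.smul_apply,
    PiLp.sub_apply, smul_eq_mul]
  ring

/-- The `CAT(0)` inequality of Bruhat and Tits. -/
lemma IsHadamardSpace.dist_sq_le {Y : Type*} [MetricSpace Y] (hY : IsHadamardSpace Y)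
    {p q : Y} {γ : ℝ → Y} (hγ : IsGeodesic γ p q) (r : Y) {t : ℝ} (ht : t ∈ Set.Icc (0 : ℝ) 1) :
    dist (γ t) r ^ 2 ≤
      (1 - t) * dist p r ^ 2 + t * dist q r ^ 2 - t * (1 - t) * dist p q ^ 2 := by
  obtain ⟨β, hβ⟩ := hY.geodesic p r
  obtain ⟨p', q', r', h1, h2, h3⟩ := exists_euclidean_triangle (a := dist p q) (b := dist p r)
    (c := dist q r) dist_nonneg dist_nonneg dist_nonneg
    (by rw [dist_comm p q]; exact dist_triangle q p r) (dist_triangle p q r)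
    (by rw [dist_comm q r]; exact dist_triangle p r q)
  have h := hY.comparison p q r γ β hγ hβ p' q' r' h1 h2 h3 t ht 1 ⟨zero_le_one, le_rfl⟩
  rw [hβ.2.1, AffineMap.lineMap_apply_one] at h
  have h' := pow_le_pow_left₀ dist_nonneg h 2
  rwa [euclidean_dist_lineMap_sq, h1, h2, h3] at h'

namespace WeightedGraph

variable {X : Type*} {G : WeightedGraph X}

/-! ### Barycenters and subharmonicity of the distance -/

lemma transProb_nonneg (x y : X) : 0 ≤ G.transProb x y :=
  div_nonneg (G.μ_nonneg x y) (tsum_nonneg fun z => G.μ_nonneg x z)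

lemma tsum_transProb {x : X} (hx : 0 < G.degree x) : ∑' y, G.transProb x y = 1 := by
  simp only [transProb, tsum_div_const]
  exact div_self hx.ne'

lemma summable_transProb (x : X) : Summable (G.transProb x) :=
  (G.μ_summable x).div_const _

lemma average_eq_tsum_transProb (f : X → ℝ) (x : X) :
    G.average f x = ∑' y, f y * G.transProb x y := by
  rw [average, ← tsum_div_const]
  refine tsum_congr fun y => ?_
  rw [transProb, degree]
  ring

lemma integral_walkMeasure_map [Countable X] [MeasurableSpace X] [DiscreteMeasurableSpace X]
    {Y : Type*} [MeasurableSpace Y] (x : X) (u : X → Y) {F : Y → ℝ} (hF : Measurable F)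
    (hs : Summable fun y => F (u y) * G.transProb x y) :
    ∫ y, F y ∂(G.walkMeasure x).map u = ∑' y, F (u y) * G.transProb x y := by
  rw [integral_map (Measurable.of_discrete).aemeasurable hF.aestronglyMeasurable, walkMeasure,
    integral_sum_dirac_eq_tsum]
  · refine tsum_congr fun y => ?_
    rw [ENNReal.toReal_ofReal (transProb_nonneg x y), smul_eq_mul, mul_comm]
  · exact fun _ => ENNReal.ofReal_ne_top
  · refine hs.abs.congr fun y => ?_
    rw [ENNReal.toReal_ofReal (transProb_nonneg x y), Real.norm_eq_abs, abs_mul,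
      abs_of_nonneg (transProb_nonneg x y), mul_comm]

/-- Factoring the difference of squares leaves the bounded factor `d(z, w)` times first moments, so
no second moment is needed. -/
lemma summable_dist_sq_sub {Y : Type*} [MetricSpace Y] {u : X → Y} (hu : u ∈ G.mapDomain Y)
    (x : X) (z w : Y) :
    Summable fun y => (dist z (u y) ^ 2 - dist w (u y) ^ 2) * G.transProb x y := by
  refine Summable.of_norm_bounded (((hu x z).add (hu x w)).mul_left (dist z w)) fun y => ?_
  have h := abs_dist_sub_le z w (u y)
  have hP := transProb_nonneg (G := G) x y
  rw [dist_comm (u y) z, dist_comm (u y) w, Real.norm_eq_abs, abs_mul, abs_of_nonneg hP, ← add_mul,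
    ← mul_assoc, sq_sub_sq, abs_mul, abs_of_nonneg (add_nonneg dist_nonneg dist_nonneg)]
  refine mul_le_mul_of_nonneg_right ?_ hP
  rw [mul_comm]
  exact mul_le_mul_of_nonneg_right h (add_nonneg dist_nonneg dist_nonneg)

/-- The variance inequality for barycenters in Hadamard spaces. -/
lemma IsHarmonicMap.dist_sq_le [Countable X] [MeasurableSpace X] [DiscreteMeasurableSpace X]
    {Y : Type*} [MetricSpace Y] [MeasurableSpace Y] [BorelSpace Y] (hY : IsHadamardSpace Y)
    {u : X → Y} (hu : G.IsHarmonicMap u) {x : X} (hx : 0 < G.degree x) (y₀ : Y) :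
    dist (u x) y₀ ^ 2 ≤
      ∑' y, (dist y₀ (u y) ^ 2 - dist (u x) (u y) ^ 2) * G.transProb x y := by
  obtain ⟨γ, hγ⟩ := hY.geodesic (u x) y₀
  set S := ∑' y, (dist y₀ (u y) ^ 2 - dist (u x) (u y) ^ 2) * G.transProb x y with hS
  have hsS := summable_dist_sq_sub hu.1 x y₀ (u x)
  -- Test minimality of `u x` against the point `γ t`, insert the `CAT(0)` inequality and divide by
  -- `t`; then `t → 0`.
  have key : ∀ t : ℝ, 0 < t → t ≤ 1 → (1 - t) * dist (u x) y₀ ^ 2 ≤ S := fun t ht0 ht1 => by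
    have hb := hu.2 x (γ t)
    have hm : Measurable fun y => dist (u x) y ^ 2 - dist (γ t) y ^ 2 := by fun_prop
    rw [integral_walkMeasure_map x u hm (summable_dist_sq_sub hu.1 x _ _)] at hb
    have hs1 := hsS.mul_left (-t)
    have hs2 := (G.summable_transProb x).mul_left (t * (1 - t) * dist (u x) y₀ ^ 2)
    have hle : ∑' y, (-t * ((dist y₀ (u y) ^ 2 - dist (u x) (u y) ^ 2) * G.transProb x y) +
        t * (1 - t) * dist (u x) y₀ ^ 2 * G.transProb x y) ≤
        ∑' y, (dist (u x) (u y) ^ 2 - dist (γ t) (u y) ^ 2) * G.transProb x y := by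
      refine (hs1.add hs2).tsum_le_tsum (fun y => ?_) (summable_dist_sq_sub hu.1 x _ _)
      have h := mul_le_mul_of_nonneg_right (hY.dist_sq_le hγ (u y) ⟨ht0.le, ht1⟩)
        (transProb_nonneg (G := G) x y)
      linarith
    rw [hs1.tsum_add hs2, tsum_mul_left, tsum_mul_left, tsum_transProb hx, ← hS] at hle
    have : t * ((1 - t) * dist (u x) y₀ ^ 2) ≤ t * S := by linarith
    exact le_of_mul_le_mul_left this ht0
  have hlim : Filter.Tendsto (fun t : ℝ => (1 - t) * dist (u x) y₀ ^ 2)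
      (nhdsWithin 0 (Set.Ioi 0)) (nhds ((1 - 0) * dist (u x) y₀ ^ 2)) :=
    (Continuous.tendsto (by fun_prop) 0).mono_left nhdsWithin_le_nhds
  rw [sub_zero, one_mul] at hlim
  refine le_of_tendsto hlim ?_
  filter_upwards [Ioc_mem_nhdsGT (zero_lt_one' ℝ)] with t ht using key t ht.1 ht.2

/-- The distance of a harmonic map to a point is subharmonic. -/
lemma IsHarmonicMap.dist_le_average [Countable X] [MeasurableSpace X] [DiscreteMeasurableSpace X]
    {Y : Type*} [MetricSpace Y] [MeasurableSpace Y] [BorelSpace Y] (hY : IsHadamardSpace Y)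
    {u : X → Y} (hu : G.IsHarmonicMap u) {x : X} (hx : 0 < G.degree x) (y₀ : Y) :
    dist (u x) y₀ ≤ G.average (fun y => dist (u y) y₀) x := by
  rw [average_eq_tsum_transProb]
  rcases (dist_nonneg (x := u x) (y := y₀)).eq_or_lt with h0 | hpos
  · rw [← h0]
    exact tsum_nonneg fun y => mul_nonneg dist_nonneg (transProb_nonneg x y)
  have h := hu.dist_sq_le hY hx y₀
  have hs1 := (hu.1 x y₀).mul_left (2 * dist (u x) y₀)
  have hs2 := (G.summable_transProb x).mul_left (dist (u x) y₀ ^ 2)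
  have hle : ∑' y, (dist y₀ (u y) ^ 2 - dist (u x) (u y) ^ 2) * G.transProb x y ≤
      ∑' y, (2 * dist (u x) y₀ * (dist (u y) y₀ * G.transProb x y) -
        dist (u x) y₀ ^ 2 * G.transProb x y) := by
    refine (summable_dist_sq_sub hu.1 x _ _).tsum_le_tsum (fun y => ?_) (hs1.sub hs2)
    -- With `d = d(u x, y₀)`, the reverse triangle inequality turns the variance inequality into `d²
    -- ≤ 2d · P d(u(·), y₀)(x) - d²`; dividing by `2d > 0` gives the claim.
    have h1 : |dist (u x) y₀ - dist (u y) y₀| ≤ dist (u x) (u y) := abs_dist_sub_le _ _ _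
    have h2 := pow_le_pow_left₀ (abs_nonneg _) h1 2
    rw [sq_abs] at h2
    rw [dist_comm y₀ (u y)]
    have h3 : dist (u y) y₀ ^ 2 - dist (u x) (u y) ^ 2 ≤
        2 * dist (u x) y₀ * dist (u y) y₀ - dist (u x) y₀ ^ 2 := by linarith
    have h4 := mul_le_mul_of_nonneg_right h3 (transProb_nonneg (G := G) x y)
    linarith
  rw [hs1.tsum_sub hs2, tsum_mul_left, tsum_mul_left, tsum_transProb hx] at hle
  have : dist (u x) y₀ * dist (u x) y₀ ≤
      dist (u x) y₀ * ∑' y, dist (u y) y₀ * G.transProb x y := by linarith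
  exact le_of_mul_le_mul_left this hpos

end WeightedGraph

end

theorem theorem1p9 {X : Type*} [Countable X] [MeasurableSpace X] [DiscreteMeasurableSpace X]
    (G : WeightedGraph X) (hG : G.Connected)
    (hbdd : ∀ f : X → ℝ, G.IsHarmonic f → G.energy f < ∞ → ∃ C : ℝ, ∀ x, |f x| ≤ C)
    {Y : Type*} [MetricSpace Y] [MeasurableSpace Y] [BorelSpace Y] (hY : IsHadamardSpace Y)
    (u : X → Y) (hu : G.IsHarmonicMap u) (hE : G.energy u < ∞) :
    Bornology.IsBounded (Set.range u) := by
  rcases subsingleton_or_nontrivial X with hX | hX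
  -- A one-vertex graph has degree zero, so averages carry no information and this case is separate.
  · exact (Set.finite_range u).isBounded
  obtain ⟨o⟩ : Nonempty X := inferInstance
  have hd := WeightedGraph.degree_pos hG
  have hf := WeightedGraph.finiteEnergy_dist hE (u o)
  obtain ⟨h, hhE, hharm, hle⟩ := hf.exists_harmonic_majorant hG hd fun x =>
    hu.dist_le_average hY (hd x) (u o)
  obtain ⟨C, hC⟩ := hbdd h (hhE.isHarmonic hd hharm) hhE.energy_lt_top
  refine (Metric.isBounded_iff_subset_closedBall (u o)).2 ⟨C, ?_⟩
  rintro _ ⟨x, rfl⟩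
  exact ((hle x).trans (le_abs_self _)).trans (hC x)
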